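/- Fix integers $N>3$ and $d\ge 1$. Consider strategies in which one quantum particle with state space $\mathbb{C}^N\otimes\mathbb{C}^d$ (location $\otimes$ internal degree of freedom) is prepared in a pure state $|\psi\rangle=\sum_{i=1}^N\sqrt{p_i}\,|i\rangle|\chi\rangle$, with $p_i\ge 0$, $\sum_i p_i=1$ and $\chi\in\mathbb{C}^d$ a unit vector; on input bits $x=(x_1,\dots,x_N)\in\{0,1\}^N$ the state is transformed by $U_x=\sum_{i=1}^N|i\rangle\langle i|\otimes U^{x_i}$, with one and the same unitary $U$ on $\mathbb{C}^d$ at every location; and an arbitrary two-outcome POVM $\{\Pi_0,\Pi_1\}$ on $\mathbb{C}^N\otimes\mathbb{C}^d$ is then measured, so that $P(a|x)=\mathrm{Tr}\big[\Pi_a U_x|\psi\rangle\langle\psi|U_x^\dagger\big]$. The violation of the fingerprinting inequality is $$\frac{1}{N+1}P(0|0\cdots 0)+\frac{1}{N+1}\sum_{k=1}^N P(1|e_k)-\frac{N}{N+1},$$ where $e_k$ is the bit string with a single $1$, in position $k$. Then: 1. For every $d\ge 2$, the maximum of the violation over all these strategies (over $p$, $\chi$, $U$ and the POVM) exists and equals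 $$\frac{1}{(N+1)(N^2-3N+1)};$$ for no internal dimension $d\ge 1$ does the violation exceed this value. 2. The value is achieved with $d=2$ and the uniform input state $p_i=1/N$. 3. A non-uniform input state cannot increase the violation: for every $d\ge1$, $\chi$ and $U$, the violation obtained with any $p$ and any POVM is at most the violation obtained with $p_i=1/N$, the same $\chi$ and $U$, and a suitable POVM. -/

import Mathlib

open scoped Kronecker ComplexOrder

/-- A one-particle quantum strategy for `N` input bits and internal dimension `d`.
The particle's state space is `ℂ^N ⊗ ℂ^d`, with basis `|i⟩ ⊗ |j⟩` indexed by `Fin N × Fin d`.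
The strategy consists of a density matrix `ρ` emitted by the source, for each location `j` and
each bit value `b` a unitary `U j b` on the internal space, and a two-outcome POVM
`{povm 0, povm 1}`. -/
structure QStrategy (N d : ℕ) where
  ρ : Matrix (Fin N × Fin d) (Fin N × Fin d) ℂ
  ρ_posSemidef : ρ.PosSemidef
  ρ_trace : ρ.trace = 1
  U : Fin N → Fin 2 → Matrix.unitaryGroup (Fin d) ℂ
  povm : Fin 2 → Matrix (Fin N × Fin d) (Fin N × Fin d) ℂ
  povm_posSemidef : ∀ a, (povm a).PosSemidef
  povm_sum : povm 0 + povm 1 = 1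

namespace QStrategy

variable {N d : ℕ}

/-- The controlled gate `U_x = ∑_j |j⟩⟨j| ⊗ U_j^{(x_j)}`. -/
noncomputable def gate (S : QStrategy N d) (x : Fin N → Fin 2) :
    Matrix (Fin N × Fin d) (Fin N × Fin d) ℂ :=
  ∑ j : Fin N, Matrix.single j j (1 : ℂ) ⊗ₖ (S.U j (x j) : Matrix (Fin d) (Fin d) ℂ)

/-- The conditional probability `P(a|x) = Tr[Π_a U_x ρ U_x†]` (the trace is a real number). -/
noncomputable def behavior (S : QStrategy N d) (a : Fin 2) (x : Fin N → Fin 2) : ℝ :=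
  (Matrix.trace (S.povm a * (S.gate x * S.ρ * (S.gate x).conjTranspose))).re

end QStrategy

/-- The left-hand side of the fingerprinting inequality
`P(0|0⋯0)/(N+1) + (1/(N+1)) ∑_k P(1|0⋯1_k⋯0) ≤ N/(N+1)`. -/
noncomputable def fingerprintLHS {N : ℕ} (P : Fin 2 → (Fin N → Fin 2) → ℝ) : ℝ :=
  1 / ((N : ℝ) + 1) * P 0 (fun _ => 0)
    + 1 / ((N : ℝ) + 1) * ∑ k : Fin N, P 1 (Pi.single k 1)

/-- The amount by which the behavior of `S` exceeds the bound of the fingerprinting inequality. -/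
noncomputable def QStrategy.violation {N d : ℕ} (S : QStrategy N d) : ℝ :=
  fingerprintLHS S.behavior - (N : ℝ) / ((N : ℝ) + 1)

/-- The coordinates of the vector `∑_i √p_i |i⟩|χ⟩`. -/
noncomputable def inputVec {N d : ℕ} (p : Fin N → ℝ) (χ : EuclideanSpace ℂ (Fin d)) :
    Fin N × Fin d → ℂ :=
  fun s => (Real.sqrt (p s.1) : ℂ) * χ s.2

/-- `S` has symmetric unitaries, with input weights `p`, internal state `χ` and encoding
unitary `V`: the input state is the pure state `∑_i √p_i |i⟩|χ⟩`, where `p` is a probability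
vector and `χ` a unit vector, and every location applies `V ^ x_i` on input bit `x_i`.
The POVM is unrestricted. -/
structure QStrategy.IsSymmetric {N d : ℕ} (S : QStrategy N d) (p : Fin N → ℝ)
    (χ : EuclideanSpace ℂ (Fin d)) (V : Matrix.unitaryGroup (Fin d) ℂ) : Prop where
  p_nonneg : ∀ i, 0 ≤ p i
  p_sum : ∑ i, p i = 1
  norm_χ : ‖χ‖ = 1
  state_eq : S.ρ = Matrix.vecMulVec (inputVec p χ) (star (inputVec p χ))
  U_eq : ∀ i b, S.U i b = V ^ (b : ℕ)

/-- The set of violations of the fingerprinting inequality that are produced by strategies with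
symmetric unitaries and internal dimension `d`. -/
def symmetricViolations (N d : ℕ) : Set ℝ :=
  {v | ∃ (S : QStrategy N d) (p : Fin N → ℝ) (χ : EuclideanSpace ℂ (Fin d))
    (V : Matrix.unitaryGroup (Fin d) ℂ), S.IsSymmetric p χ V ∧ S.violation = v}

/-!
Write `ψ_x` for the input vector after the gates for the bit string `x`, and `m = N² - 3N + 1`.
As `P(0|x) + P(1|x) = 1`, the violation is `(P(0|0⋯0) - ∑ k, P(0|e_k)) / (N + 1)`, where
`P(0|x)` is the value at `ψ_x` of the quadratic form of `Π₀`.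

*Upper bound.* The gates act locally, so `∑ k, ψ_{e_k} = (N - 1) ψ_{0⋯0} + ψ_{1⋯1}`, whatever the
input weights are. By convexity, `∑ k, P(0|e_k)` is at least `1 / N` times the form at this
sum, and completing the square in `ψ_{0⋯0}` leaves
`P(0|0⋯0) - ∑ k, P(0|e_k) ≤ P(0|1⋯1) / m ≤ 1 / m` (`norm_sq_sub_sum_norm_sq_le`,
`QStrategy.IsSymmetric.violation_le`).

*Attainment.* For uniform weights and `Π₀` the projection onto `ψ_{1⋯1}`, all steps above are
equalities as soon as `⟨χ, V χ⟩ = -(N - 1) / m` (`exists_violation_eq`). For `N > 3` this number lies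
in `[-1, 1]`, so it occurs for a Householder reflection `V` once `d ≥ 2`
(`exists_unitary_dotProduct`).

*Uniform weights suffice.* The measurement can turn the uniform input into a uniform mixture of
the cyclic shifts of the input with weights `p`: with `D_g` the diagonal matrix of the
`√p_{i+g}`, the map `Π ↦ ∑ g, D_g (Π shifted by g) D_g` is positive and unital, because
`∑ g, p_{i+g} = 1`. The new behavior is the average over `g` of the old one on shifted inputs
(`quadForm_cyclicAverage`), and the fingerprinting expression is invariant under shifts.
-/

open Matrix

/-! ### Output states and the Born rule -/

/-- The coordinates of the vector `∑ i, √p_i |i⟩ V^{x_i}|χ⟩`, the state after the gates. -/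
noncomputable def outputVec {N d : ℕ} (p : Fin N → ℝ) (χ : EuclideanSpace ℂ (Fin d))
    (V : Matrix.unitaryGroup (Fin d) ℂ) (x : Fin N → Fin 2) : Fin N × Fin d → ℂ :=
  fun s => (Real.sqrt (p s.1) : ℂ) * (((V ^ (x s.1 : ℕ) : Matrix.unitaryGroup (Fin d) ℂ) :
    Matrix (Fin d) (Fin d) ℂ) *ᵥ χ.ofLp) s.2

/-- The real part of `⟨v, M v⟩`. -/
def quadForm {ι : Type*} [Fintype ι] (M : Matrix ι ι ℂ) (v : ι → ℂ) : ℝ :=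
  (star v ⬝ᵥ M *ᵥ v).re

theorem QStrategy.gate_apply {N d : ℕ} (S : QStrategy N d) (x : Fin N → Fin 2)
    (s t : Fin N × Fin d) :
    S.gate x s t = if s.1 = t.1 then (S.U s.1 (x s.1) : Matrix (Fin d) (Fin d) ℂ) s.2 t.2
      else 0 := by
  simp only [QStrategy.gate, Matrix.sum_apply, Matrix.kroneckerMap_apply, Matrix.single_apply]
  rw [Finset.sum_eq_single s.1]
  · by_cases h : s.1 = t.1 <;> simp [h]
  · intro b _ hb
    simp [hb]
  · simp

theorem QStrategy.IsSymmetric.gate_mulVec {N d : ℕ} {S : QStrategy N d} {p : Fin N → ℝ}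
    {χ : EuclideanSpace ℂ (Fin d)} {V : Matrix.unitaryGroup (Fin d) ℂ}
    (h : S.IsSymmetric p χ V) (x : Fin N → Fin 2) :
    S.gate x *ᵥ inputVec p χ = outputVec p χ V x := by
  ext ⟨i, j⟩
  simp only [Matrix.mulVec, dotProduct, QStrategy.gate_apply, inputVec, outputVec,
    Fintype.sum_prod_type, h.U_eq, Finset.mul_sum]
  rw [Finset.sum_eq_single i]
  · simp only [if_true]
    exact Finset.sum_congr rfl fun _ _ => by ring
  · intro b _ hb
    simp [hb.symm]
  · simp

theorem QStrategy.IsSymmetric.behavior_eq {N d : ℕ} {S : QStrategy N d} {p : Fin N → ℝ}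
    {χ : EuclideanSpace ℂ (Fin d)} {V : Matrix.unitaryGroup (Fin d) ℂ}
    (h : S.IsSymmetric p χ V) (a : Fin 2) (x : Fin N → Fin 2) :
    S.behavior a x = quadForm (S.povm a) (outputVec p χ V x) := by
  rw [QStrategy.behavior, quadForm, h.state_eq, Matrix.mul_vecMulVec, Matrix.vecMulVec_mul,
    ← Matrix.star_mulVec, Matrix.mul_vecMulVec, Matrix.trace_vecMulVec, h.gate_mulVec,
    dotProduct_comm]

theorem star_dotProduct_unitary_mulVec {ι : Type*} [Fintype ι] [DecidableEq ι]
    (V : Matrix.unitaryGroup ι ℂ) (v : ι → ℂ) :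
    star ((V : Matrix ι ι ℂ) *ᵥ v) ⬝ᵥ ((V : Matrix ι ι ℂ) *ᵥ v) = star v ⬝ᵥ v := by
  rw [Matrix.star_mulVec, ← Matrix.dotProduct_mulVec, Matrix.mulVec_mulVec,
    ← Matrix.star_eq_conjTranspose, Matrix.UnitaryGroup.star_mul_self, Matrix.one_mulVec]

theorem star_dotProduct_self_of_norm_eq_one {d : ℕ} {χ : EuclideanSpace ℂ (Fin d)}
    (hχ : ‖χ‖ = 1) : star χ.ofLp ⬝ᵥ χ.ofLp = 1 := by
  have := inner_self_eq_norm_sq_to_K (𝕜 := ℂ) χ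
  rw [hχ, EuclideanSpace.inner_eq_star_dotProduct, dotProduct_comm] at this
  simpa using this

theorem star_outputVec_dotProduct {N d : ℕ} {p : Fin N → ℝ} (hp : ∀ i, 0 ≤ p i)
    (χ : EuclideanSpace ℂ (Fin d)) (V : Matrix.unitaryGroup (Fin d) ℂ) (x y : Fin N → Fin 2) :
    star (outputVec p χ V x) ⬝ᵥ outputVec p χ V y = ∑ i, (p i : ℂ) *
      (star (((V ^ (x i : ℕ) : Matrix.unitaryGroup (Fin d) ℂ) :
        Matrix (Fin d) (Fin d) ℂ) *ᵥ χ.ofLp) ⬝ᵥ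
      (((V ^ (y i : ℕ) : Matrix.unitaryGroup (Fin d) ℂ) :
        Matrix (Fin d) (Fin d) ℂ) *ᵥ χ.ofLp)) := by
  simp only [dotProduct, Fintype.sum_prod_type, Finset.mul_sum, outputVec, Pi.star_apply]
  refine Finset.sum_congr rfl fun i _ => Finset.sum_congr rfl fun j _ => ?_
  have hs : ((Real.sqrt (p i) : ℝ) : ℂ) * ((Real.sqrt (p i) : ℝ) : ℂ) = (p i : ℂ) := by
    rw [← Complex.ofReal_mul, Real.mul_self_sqrt (hp i)]
  rw [← hs, star_mul']
  simp only [Complex.star_def, Complex.conj_ofReal]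
  ring

theorem star_outputVec_dotProduct_self {N d : ℕ} {p : Fin N → ℝ} (hp : ∀ i, 0 ≤ p i)
    (hp1 : ∑ i, p i = 1) {χ : EuclideanSpace ℂ (Fin d)} (hχ : ‖χ‖ = 1)
    (V : Matrix.unitaryGroup (Fin d) ℂ) (x : Fin N → Fin 2) :
    star (outputVec p χ V x) ⬝ᵥ outputVec p χ V x = 1 := by
  rw [star_outputVec_dotProduct hp]
  simp only [star_dotProduct_unitary_mulVec, star_dotProduct_self_of_norm_eq_one hχ, mul_one]
  rw [← Complex.ofReal_sum, hp1, Complex.ofReal_one]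

theorem QStrategy.IsSymmetric.behavior_add {N d : ℕ} {S : QStrategy N d} {p : Fin N → ℝ}
    {χ : EuclideanSpace ℂ (Fin d)} {V : Matrix.unitaryGroup (Fin d) ℂ}
    (h : S.IsSymmetric p χ V) (x : Fin N → Fin 2) :
    S.behavior 0 x + S.behavior 1 x = 1 := by
  rw [h.behavior_eq, h.behavior_eq, quadForm, quadForm, ← Complex.add_re, ← dotProduct_add,
    ← Matrix.add_mulVec, S.povm_sum, Matrix.one_mulVec,
    star_outputVec_dotProduct_self h.p_nonneg h.p_sum h.norm_χ, Complex.one_re]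

theorem QStrategy.IsSymmetric.violation_eq {N d : ℕ} {S : QStrategy N d} {p : Fin N → ℝ}
    {χ : EuclideanSpace ℂ (Fin d)} {V : Matrix.unitaryGroup (Fin d) ℂ}
    (h : S.IsSymmetric p χ V) :
    S.violation = (S.behavior 0 (fun _ => 0) - ∑ k, S.behavior 0 (Pi.single k 1)) /
      ((N : ℝ) + 1) := by
  have h1 : ∀ x, S.behavior 1 x = 1 - S.behavior 0 x := fun x => by
    linarith [h.behavior_add x]
  rw [QStrategy.violation, fingerprintLHS]
  simp only [h1, Finset.sum_sub_distrib, Finset.sum_const, Finset.card_univ, Fintype.card_fin,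
    nsmul_eq_mul, mul_one]
  ring

/-! ### The upper bound -/

/-- Locality of the gates: each location is switched on in exactly one of the `N` terms. -/
theorem sum_outputVec_single {N d : ℕ} (p : Fin N → ℝ)
    (χ : EuclideanSpace ℂ (Fin d)) (V : Matrix.unitaryGroup (Fin d) ℂ) :
    ∑ k, outputVec p χ V (Pi.single k 1) =
      ((N - 1 : ℝ) : ℂ) • outputVec p χ V (fun _ => 0) + outputVec p χ V (fun _ => 1) := by
  ext ⟨i, j⟩
  have hk : ∀ k : Fin N, outputVec p χ V (Pi.single k 1) (i, j) =
      outputVec p χ V (fun _ => 0) (i, j) + if i = k then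
        outputVec p χ V (fun _ => 1) (i, j) - outputVec p χ V (fun _ => 0) (i, j) else 0 := by
    intro k
    by_cases h : i = k
    · subst h
      simp [outputVec]
    · simp [outputVec, h]
  simp only [Finset.sum_apply, hk, Finset.sum_add_distrib, Finset.sum_ite_eq, Finset.mem_univ,
    if_true, Finset.sum_const, Finset.card_univ, Fintype.card_fin, nsmul_eq_mul, Pi.add_apply,
    Pi.smul_apply, smul_eq_mul]
  push_cast
  ring

/-- The square completed here is `m * ‖a + ((N - 1) / m) • t‖ ^ 2`, with `m = N² - 3N + 1`;
it works out because `(N - 1)² = m + N`. -/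
theorem norm_sq_sub_sum_norm_sq_le {E : Type*} [NormedAddCommGroup E] [InnerProductSpace ℂ E]
    {N : ℕ} (hN : 0 < N) (hm : 0 < (N : ℝ) ^ 2 - 3 * N + 1) (a t : E) (c : Fin N → E)
    (hc : ∑ k, c k = ((N - 1 : ℝ) : ℂ) • a + t) :
    ‖a‖ ^ 2 - ∑ k, ‖c k‖ ^ 2 ≤ ‖t‖ ^ 2 / ((N : ℝ) ^ 2 - 3 * N + 1) := by
  have hN0 : (0 : ℝ) < N := by exact_mod_cast hN
  have hJ : ‖∑ k, c k‖ ^ 2 ≤ N * ∑ k, ‖c k‖ ^ 2 := by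
    calc ‖∑ k, c k‖ ^ 2 ≤ (∑ k, ‖c k‖) ^ 2 := by
          gcongr
          exact norm_sum_le _ _
      _ ≤ N * ∑ k, ‖c k‖ ^ 2 := by
          simpa using sq_sum_le_card_mul_sum_sq (s := Finset.univ) (f := fun k => ‖c k‖)
  rw [hc, norm_add_sq (𝕜 := ℂ)] at hJ
  set m : ℝ := (N : ℝ) ^ 2 - 3 * N + 1 with hmdef
  have hS := sq_nonneg ‖((m : ℝ) : ℂ) • a + ((N - 1 : ℝ) : ℂ) • t‖
  rw [norm_add_sq (𝕜 := ℂ)] at hS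
  simp only [inner_smul_left, inner_smul_right, Complex.conj_ofReal, norm_smul, mul_pow,
    Complex.norm_real, Real.norm_eq_abs, sq_abs] at hS hJ
  simp only [RCLike.re_to_complex, Complex.re_ofReal_mul] at hS hJ
  rw [le_div_iff₀ hm]
  have hmul := mul_le_mul_of_nonneg_left hJ hm.le
  have key : 0 ≤ N * (‖t‖ ^ 2 - (‖a‖ ^ 2 - ∑ k, ‖c k‖ ^ 2) * m) := by
    have e : (m : ℝ) = (N : ℝ) ^ 2 - 3 * N + 1 := hmdef
    have e2 : ((N : ℝ) - 1) ^ 2 = m + N := by rw [e]; ring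
    rw [e2] at hS hmul
    nlinarith [hS, hmul]
  nlinarith [nonneg_of_mul_nonneg_right key hN0]

theorem exists_quadForm_eq_norm_sq {ι : Type*} [Fintype ι] [DecidableEq ι] {M : Matrix ι ι ℂ}
    (hM : M.PosSemidef) :
    ∃ L : (ι → ℂ) →ₗ[ℂ] EuclideanSpace ℂ ι, ∀ v, quadForm M v = ‖L v‖ ^ 2 := by
  obtain ⟨B, rfl⟩ : ∃ B : Matrix ι ι ℂ, M = Bᴴ * B := by
    open scoped MatrixOrder in
    exact CStarAlgebra.nonneg_iff_eq_star_mul_self.mp hM.nonneg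
  refine ⟨(WithLp.linearEquiv 2 ℂ (ι → ℂ)).symm.toLinearMap ∘ₗ B.mulVecLin, fun v => ?_⟩
  rw [quadForm, ← Matrix.mulVec_mulVec, Matrix.dotProduct_mulVec, ← Matrix.star_mulVec,
    ← inner_self_eq_norm_sq (𝕜 := ℂ), EuclideanSpace.inner_eq_star_dotProduct, dotProduct_comm]
  rfl

theorem QStrategy.IsSymmetric.violation_le {N d : ℕ} (hN : 3 < N) {S : QStrategy N d}
    {p : Fin N → ℝ} {χ : EuclideanSpace ℂ (Fin d)} {V : Matrix.unitaryGroup (Fin d) ℂ}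
    (h : S.IsSymmetric p χ V) :
    S.violation ≤ 1 / (((N : ℝ) + 1) * ((N : ℝ) ^ 2 - 3 * (N : ℝ) + 1)) := by
  have hN' : (3 : ℝ) < N := by exact_mod_cast hN
  have hm : 0 < (N : ℝ) ^ 2 - 3 * N + 1 := by nlinarith
  obtain ⟨L, hL⟩ := exists_quadForm_eq_norm_sq (S.povm_posSemidef 0)
  obtain ⟨L', hL'⟩ := exists_quadForm_eq_norm_sq (S.povm_posSemidef 1)
  have hle : S.behavior 0 (fun _ => 1) ≤ 1 := by
    have h1 : 0 ≤ S.behavior 1 (fun _ => 1) := by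
      rw [h.behavior_eq, hL']
      positivity
    linarith [h.behavior_add (fun _ => 1)]
  have hb := norm_sq_sub_sum_norm_sq_le (by lia) hm (L (outputVec p χ V fun _ => 0))
    (L (outputVec p χ V fun _ => 1)) (fun k => L (outputVec p χ V (Pi.single k 1)))
    (by rw [← map_sum, sum_outputVec_single, map_add, map_smul])
  simp only [← hL, ← h.behavior_eq] at hb
  rw [h.violation_eq, mul_comm, ← div_div]
  gcongr
  exact hb.trans (by gcongr)

/-! ### Optimal strategies -/

theorem sum_one_div_card {N : ℕ} (hN : 0 < N) : ∑ _i : Fin N, 1 / (N : ℝ) = 1 := by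
  have : (N : ℝ) ≠ 0 := by exact_mod_cast hN.ne'
  simp [this]

theorem posSemidef_one_sub_vecMulVec {ι : Type*} [Fintype ι] [DecidableEq ι] {v : ι → ℂ}
    (hv : star v ⬝ᵥ v = 1) : (1 - vecMulVec v (star v)).PosSemidef := by
  have hH : (1 - vecMulVec v (star v))ᴴ = 1 - vecMulVec v (star v) := by
    rw [conjTranspose_sub, conjTranspose_one, conjTranspose_vecMulVec, star_star]
  have hP : vecMulVec v (star v) * vecMulVec v (star v) = vecMulVec v (star v) := by
    rw [vecMulVec_mul_vecMulVec, hv, one_smul]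
  have := posSemidef_conjTranspose_mul_self (1 - vecMulVec v (star v))
  rwa [hH, mul_sub, sub_mul, sub_mul, hP, one_mul, mul_one, one_mul, sub_self, sub_zero] at this

/-- The strategy with symmetric unitaries, given by its input state and its POVM. -/
noncomputable def symmetricStrategy {N d : ℕ} (p : Fin N → ℝ) (hp : ∀ i, 0 ≤ p i)
    (hp1 : ∑ i, p i = 1) (χ : EuclideanSpace ℂ (Fin d)) (hχ : ‖χ‖ = 1)
    (V : Matrix.unitaryGroup (Fin d) ℂ)
    (E : Fin 2 → Matrix (Fin N × Fin d) (Fin N × Fin d) ℂ) (hE : ∀ a, (E a).PosSemidef)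
    (hE1 : E 0 + E 1 = 1) : QStrategy N d where
  ρ := vecMulVec (inputVec p χ) (star (inputVec p χ))
  ρ_posSemidef := posSemidef_vecMulVec_self_star _
  ρ_trace := by
    have h0 : inputVec p χ = outputVec p χ 1 (fun _ => 0) := by
      ext s
      simp [inputVec, outputVec]
    rw [trace_vecMulVec, dotProduct_comm, h0, star_outputVec_dotProduct_self hp hp1 hχ]
  U := fun _ b => V ^ (b : ℕ)
  povm := E
  povm_posSemidef := hE
  povm_sum := hE1

theorem isSymmetric_symmetricStrategy {N d : ℕ} (p : Fin N → ℝ) (hp : ∀ i, 0 ≤ p i)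
    (hp1 : ∑ i, p i = 1) (χ : EuclideanSpace ℂ (Fin d)) (hχ : ‖χ‖ = 1)
    (V : Matrix.unitaryGroup (Fin d) ℂ)
    (E : Fin 2 → Matrix (Fin N × Fin d) (Fin N × Fin d) ℂ) (hE : ∀ a, (E a).PosSemidef)
    (hE1 : E 0 + E 1 = 1) :
    (symmetricStrategy p hp hp1 χ hχ V E hE hE1).IsSymmetric p χ V :=
  ⟨hp, hp1, hχ, rfl, fun _ _ => rfl⟩

theorem quadForm_vecMulVec {ι : Type*} [Fintype ι] (v w : ι → ℂ) :
    quadForm (vecMulVec v (star v)) w = Complex.normSq (star v ⬝ᵥ w) := by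
  rw [quadForm, vecMulVec_mulVec, dotProduct_smul, MulOpposite.smul_eq_mul_unop,
    MulOpposite.unop_op,
    show star w ⬝ᵥ v = star (star v ⬝ᵥ w) by rw [← star_dotProduct_star, star_star],
    Complex.star_def, ← Complex.normSq_eq_conj_mul_self, Complex.ofReal_re]

theorem exists_violation_eq {N d : ℕ} (hN : 3 < N) {χ : EuclideanSpace ℂ (Fin d)}
    (hχ : ‖χ‖ = 1) {V : Matrix.unitaryGroup (Fin d) ℂ}
    (hc : star ((V : Matrix (Fin d) (Fin d) ℂ) *ᵥ χ.ofLp) ⬝ᵥ χ.ofLp =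
      ((-((N : ℝ) - 1) / ((N : ℝ) ^ 2 - 3 * N + 1) : ℝ) : ℂ)) :
    ∃ S : QStrategy N d, S.IsSymmetric (fun _ => 1 / (N : ℝ)) χ V ∧
      S.violation = 1 / (((N : ℝ) + 1) * ((N : ℝ) ^ 2 - 3 * (N : ℝ) + 1)) := by
  have hN' : (3 : ℝ) < N := by exact_mod_cast hN
  have hm : 0 < (N : ℝ) ^ 2 - 3 * N + 1 := by nlinarith
  have hp : ∀ i : Fin N, 0 ≤ (fun _ : Fin N => 1 / (N : ℝ)) i := fun _ => by positivity
  have hp1 := sum_one_div_card (N := N) (by lia)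
  set p : Fin N → ℝ := fun _ => 1 / (N : ℝ) with hpdef
  set θ := outputVec p χ V (fun _ => 1) with hθ
  have hθ1 : star θ ⬝ᵥ θ = 1 := star_outputVec_dotProduct_self hp hp1 hχ V _
  let E : Fin 2 → Matrix (Fin N × Fin d) (Fin N × Fin d) ℂ :=
    ![vecMulVec θ (star θ), 1 - vecMulVec θ (star θ)]
  have hE : ∀ a, (E a).PosSemidef := by
    intro a
    fin_cases a
    · exact posSemidef_vecMulVec_self_star _
    · exact posSemidef_one_sub_vecMulVec hθ1
  have hE1 : E 0 + E 1 = 1 := by simp [E]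
  have hS := isSymmetric_symmetricStrategy p hp hp1 χ hχ V E hE hE1
  refine ⟨_, hS, ?_⟩
  set c : ℝ := -((N : ℝ) - 1) / ((N : ℝ) ^ 2 - 3 * N + 1) with hcdef
  have h0 : star θ ⬝ᵥ outputVec p χ V (fun _ => 0) = (c : ℂ) := by
    rw [hθ, star_outputVec_dotProduct hp]
    simp only [Fin.val_zero, Fin.val_one, pow_zero, pow_one, UnitaryGroup.one_val, one_mulVec, hc]
    rw [← Finset.sum_mul, ← Complex.ofReal_sum, hp1, Complex.ofReal_one, one_mul]
  have hk : ∀ k, star θ ⬝ᵥ outputVec p χ V (Pi.single k 1) =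
      ((((N : ℝ) - 1) * c + 1) / N : ℝ) := by
    intro k
    rw [hθ, star_outputVec_dotProduct hp]
    have hi : ∀ i, (p i : ℂ) * (star (((V ^ (((fun _ => 1 : Fin N → Fin 2) i : Fin 2) : ℕ) :
        Matrix.unitaryGroup (Fin d) ℂ) : Matrix (Fin d) (Fin d) ℂ) *ᵥ χ.ofLp) ⬝ᵥ
        (((V ^ ((Pi.single k 1 : Fin N → Fin 2) i : ℕ) : Matrix.unitaryGroup (Fin d) ℂ) :
        Matrix (Fin d) (Fin d) ℂ) *ᵥ χ.ofLp)) =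
        ((1 / N * c + if i = k then 1 / N * (1 - c) else 0 : ℝ) : ℂ) := by
      intro i
      by_cases h : i = k
      · subst h
        simp only [Pi.single_eq_same, star_dotProduct_unitary_mulVec,
          star_dotProduct_self_of_norm_eq_one hχ, if_true, hpdef]
        push_cast
        ring
      · simp only [Pi.single_eq_of_ne h, h, if_false, Fin.val_zero, Fin.val_one, pow_zero,
          pow_one, UnitaryGroup.one_val, one_mulVec, hc, hpdef]
        push_cast
        ring
    rw [Finset.sum_congr rfl fun i _ => hi i, ← Complex.ofReal_sum]
    congr 1
    simp only [Finset.sum_add_distrib, Finset.sum_const, Finset.card_univ, Fintype.card_fin,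
      nsmul_eq_mul, Finset.sum_ite_eq', Finset.mem_univ, if_true]
    field_simp
    ring
  rw [hS.violation_eq]
  simp only [hS.behavior_eq]
  have hE0 : (symmetricStrategy p hp hp1 χ hχ V E hE hE1).povm 0 = vecMulVec θ (star θ) := rfl
  simp only [hE0, quadForm_vecMulVec, h0, hk, Complex.normSq_ofReal, Finset.sum_const,
    Finset.card_univ, Fintype.card_fin, nsmul_eq_mul]
  set m : ℝ := (N : ℝ) ^ 2 - 3 * N + 1 with hmdef
  have hsq : ((N : ℝ) - 1) ^ 2 = m + N := by rw [hmdef]; ring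
  have hq : (((N : ℝ) - 1) * c + 1) / N = -1 / m := by
    rw [hcdef]
    field_simp
    linear_combination -hsq
  rw [hq, hcdef]
  field_simp
  linear_combination hsq

/-- The reflection in the hyperplane orthogonal to a unit vector `z` has `⟨χ, V χ⟩ = 1 - 2|z₀|²`
for `χ` the first basis vector, which takes every value in `[-1, 1]`. -/
theorem exists_unitary_dotProduct {d : ℕ} (hd : 2 ≤ d) {c : ℝ} (hc : -1 ≤ c) (hc' : c ≤ 1) :
    ∃ (χ : EuclideanSpace ℂ (Fin d)) (V : Matrix.unitaryGroup (Fin d) ℂ), ‖χ‖ = 1 ∧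
      star ((V : Matrix (Fin d) (Fin d) ℂ) *ᵥ χ.ofLp) ⬝ᵥ χ.ofLp = (c : ℂ) := by
  let i₀ : Fin d := ⟨0, by lia⟩
  let i₁ : Fin d := ⟨1, by lia⟩
  have hne : i₁ ≠ i₀ := by simp [i₀, i₁]
  let z : Fin d → ℂ := Pi.single i₀ ((Real.sqrt ((1 - c) / 2) : ℝ) : ℂ) +
    Pi.single i₁ ((Real.sqrt ((1 + c) / 2) : ℝ) : ℂ)
  have s0 : ((Real.sqrt ((1 - c) / 2) : ℝ) : ℂ) * ((Real.sqrt ((1 - c) / 2) : ℝ) : ℂ) =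
      (1 - c) / 2 := by
    rw [← Complex.ofReal_mul, Real.mul_self_sqrt (by linarith)]
    push_cast
    rfl
  have s1 : ((Real.sqrt ((1 + c) / 2) : ℝ) : ℂ) * ((Real.sqrt ((1 + c) / 2) : ℝ) : ℂ) =
      (1 + c) / 2 := by
    rw [← Complex.ofReal_mul, Real.mul_self_sqrt (by linarith)]
    push_cast
    rfl
  have hzs : star z = z := by
    ext i
    by_cases h0 : i = i₀
    · subst h0
      simp [z, hne.symm]
    · by_cases h1 : i = i₁
      · subst h1
        simp [z, hne]
      · simp [z, h0, h1]
  have hz0 : z i₀ = ((Real.sqrt ((1 - c) / 2) : ℝ) : ℂ) := by simp [z, hne.symm]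
  have hz1 : z i₁ = ((Real.sqrt ((1 + c) / 2) : ℝ) : ℂ) := by simp [z, hne]
  have hz : star z ⬝ᵥ z = 1 := by
    rw [hzs]
    nth_rewrite 1 [show z = Pi.single i₀ ((Real.sqrt ((1 - c) / 2) : ℝ) : ℂ) +
      Pi.single i₁ ((Real.sqrt ((1 + c) / 2) : ℝ) : ℂ) from rfl]
    rw [add_dotProduct, single_dotProduct, single_dotProduct, hz0, hz1, s0, s1]
    ring
  let W : Matrix (Fin d) (Fin d) ℂ := 1 - (2 : ℂ) • vecMulVec z (star z)
  have hWs : star W = W := by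
    simp [W, star_eq_conjTranspose, conjTranspose_vecMulVec]
  have hP : vecMulVec z (star z) * vecMulVec z (star z) = vecMulVec z (star z) := by
    rw [vecMulVec_mul_vecMulVec, hz, one_smul]
  have hWW : W * W = 1 := by
    simp only [W, mul_sub, sub_mul, mul_one, one_mul, smul_mul_smul_comm, hP]
    module
  refine ⟨EuclideanSpace.single i₀ 1, ⟨W, ?_⟩, by simp, ?_⟩
  · rw [Matrix.mem_unitaryGroup_iff, hWs, hWW]
  · have hz0s : star z i₀ = z i₀ := by rw [hzs]
    have hre : (starRingEnd ℂ) (W i₀ i₀) = (c : ℂ) := by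
      have : W i₀ i₀ = (c : ℂ) := by
        simp only [W, Matrix.sub_apply, Matrix.one_apply_eq, Matrix.smul_apply, vecMulVec_apply,
          hz0s, hz0, s0, smul_eq_mul]
        ring
      rw [this, Complex.conj_ofReal]
    simpa [EuclideanSpace.single] using hre

theorem exists_optimal_strategy {N d : ℕ} (hN : 3 < N) (hd : 2 ≤ d) :
    ∃ (S : QStrategy N d) (χ : EuclideanSpace ℂ (Fin d)) (V : Matrix.unitaryGroup (Fin d) ℂ),
      S.IsSymmetric (fun _ => 1 / (N : ℝ)) χ V ∧
      S.violation = 1 / (((N : ℝ) + 1) * ((N : ℝ) ^ 2 - 3 * (N : ℝ) + 1)) := by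
  have hN' : (4 : ℝ) ≤ N := by exact_mod_cast hN
  have hm : 0 < (N : ℝ) ^ 2 - 3 * N + 1 := by nlinarith
  -- `N > 3` enters here: `N - 1 ≤ N² - 3N + 1` fails for `N = 3`.
  obtain ⟨χ, V, hχ, hc⟩ := exists_unitary_dotProduct hd
    (c := -((N : ℝ) - 1) / ((N : ℝ) ^ 2 - 3 * N + 1))
    (by rw [le_div_iff₀ hm]; nlinarith) (by rw [div_le_iff₀ hm]; nlinarith)
  obtain ⟨S, hS, hv⟩ := exists_violation_eq hN hχ hc
  exact ⟨S, χ, V, hS, hv⟩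

/-! ### Reduction to the uniform input state -/

/-- The cyclic shift of the location by `g`. -/
def shiftLocation {N : ℕ} [NeZero N] (d : ℕ) (g : Fin N) : Fin N × Fin d ≃ Fin N × Fin d :=
  (Equiv.addRight g).prodCongr (Equiv.refl _)

/-- The diagonal matrix of the square roots of the shifted weights, acting on the location. -/
noncomputable def sqrtWeight {N : ℕ} [NeZero N] (d : ℕ) (p : Fin N → ℝ) (g : Fin N) :
    Matrix (Fin N × Fin d) (Fin N × Fin d) ℂ :=
  diagonal fun s => ((Real.sqrt (p (s.1 + g)) : ℝ) : ℂ)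

/-- The effect which, on the uniform input state, acts as the average over all cyclic shifts of
the effect `M` on the input state with weights `p`. -/
noncomputable def cyclicAverage {N d : ℕ} [NeZero N] (p : Fin N → ℝ)
    (M : Matrix (Fin N × Fin d) (Fin N × Fin d) ℂ) :
    Matrix (Fin N × Fin d) (Fin N × Fin d) ℂ :=
  ∑ g : Fin N, sqrtWeight d p g * M.submatrix (shiftLocation d g) (shiftLocation d g) *
    sqrtWeight d p g

theorem conjTranspose_sqrtWeight {N d : ℕ} [NeZero N] (p : Fin N → ℝ) (g : Fin N) :
    (sqrtWeight d p g)ᴴ = sqrtWeight d p g := by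
  rw [sqrtWeight, diagonal_conjTranspose]
  congr 1
  ext s
  simp

theorem posSemidef_cyclicAverage {N d : ℕ} [NeZero N] (p : Fin N → ℝ)
    {M : Matrix (Fin N × Fin d) (Fin N × Fin d) ℂ} (hM : M.PosSemidef) :
    (cyclicAverage p M).PosSemidef := by
  refine posSemidef_sum _ fun g _ => ?_
  have := (hM.submatrix (shiftLocation d g)).conjTranspose_mul_mul_same (sqrtWeight d p g)
  rwa [conjTranspose_sqrtWeight] at this

theorem cyclicAverage_add {N d : ℕ} [NeZero N] (p : Fin N → ℝ)
    (M M' : Matrix (Fin N × Fin d) (Fin N × Fin d) ℂ) :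
    cyclicAverage p M + cyclicAverage p M' = cyclicAverage p (M + M') := by
  simp only [cyclicAverage, ← Finset.sum_add_distrib, submatrix_add, Pi.add_apply, mul_add,
    add_mul]

theorem cyclicAverage_one {N d : ℕ} [NeZero N] {p : Fin N → ℝ} (hp : ∀ i, 0 ≤ p i)
    (hp1 : ∑ i, p i = 1) :
    cyclicAverage p (1 : Matrix (Fin N × Fin d) (Fin N × Fin d) ℂ) = 1 := by
  simp only [cyclicAverage, submatrix_one_equiv, mul_one, sqrtWeight, diagonal_mul_diagonal]
  simp only [← Complex.ofReal_mul, Real.mul_self_sqrt (hp _)]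
  ext s t
  rw [Matrix.sum_apply]
  by_cases h : s = t
  · subst h
    simp only [diagonal_apply_eq, one_apply_eq, ← Complex.ofReal_sum]
    rw [show ∑ g, p (s.1 + g) = ∑ i, p i from Equiv.sum_comp (Equiv.addLeft s.1) p, hp1,
      Complex.ofReal_one]
  · simp [h]

theorem quadForm_cyclicAverage {N d : ℕ} [NeZero N] (p : Fin N → ℝ)
    (χ : EuclideanSpace ℂ (Fin d)) (V : Matrix.unitaryGroup (Fin d) ℂ) (x : Fin N → Fin 2)
    (M : Matrix (Fin N × Fin d) (Fin N × Fin d) ℂ) :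
    quadForm (cyclicAverage p M) (outputVec (fun _ => 1 / (N : ℝ)) χ V x) =
      1 / N * ∑ g, quadForm M (outputVec p χ V fun i => x (i - g)) := by
  have hg : ∀ g, sqrtWeight d p g *ᵥ outputVec (fun _ => 1 / (N : ℝ)) χ V x =
      ((Real.sqrt (1 / N) : ℝ) : ℂ) •
        (outputVec p χ V (fun i => x (i - g)) ∘ shiftLocation d g) := by
    intro g
    ext ⟨i, j⟩
    simp only [sqrtWeight, mulVec_diagonal, outputVec, shiftLocation, Function.comp_apply,
      Pi.smul_apply, smul_eq_mul, Equiv.prodCongr_apply, Prod.map_apply, Equiv.coe_addRight,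
      Equiv.refl_apply, add_sub_cancel_right]
    ring
  simp only [quadForm, cyclicAverage, sum_mulVec, dotProduct_sum, Complex.re_sum, Finset.mul_sum]
  refine Finset.sum_congr rfl fun g _ => ?_
  rw [← mulVec_mulVec, ← mulVec_mulVec, dotProduct_mulVec]
  nth_rewrite 1 [← conjTranspose_sqrtWeight p g]
  rw [← star_mulVec, hg, mulVec_smul, star_smul, smul_dotProduct, dotProduct_smul, smul_smul,
    Complex.star_def, Complex.conj_ofReal, ← Complex.ofReal_mul,
    Real.mul_self_sqrt (by positivity), smul_eq_mul, Complex.re_ofReal_mul]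
  congr 2
  set v := outputVec p χ V fun i => x (i - g)
  have h1 : M.submatrix (shiftLocation d g) (shiftLocation d g) *ᵥ (v ∘ shiftLocation d g) =
      (M *ᵥ v) ∘ shiftLocation d g := by
    rw [submatrix_mulVec_equiv, Function.comp_assoc, Equiv.self_comp_symm, Function.comp_id]
  rw [h1]
  exact comp_equiv_dotProduct_comp_equiv (star v) _ _

theorem QStrategy.IsSymmetric.exists_uniform {N d : ℕ} (hN : 0 < N) {S : QStrategy N d}
    {p : Fin N → ℝ} {χ : EuclideanSpace ℂ (Fin d)} {V : Matrix.unitaryGroup (Fin d) ℂ}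
    (h : S.IsSymmetric p χ V) :
    ∃ S' : QStrategy N d, S'.IsSymmetric (fun _ => 1 / (N : ℝ)) χ V ∧
      S.violation = S'.violation := by
  have : NeZero N := ⟨hN.ne'⟩
  have hN0 : (N : ℝ) ≠ 0 := by exact_mod_cast hN.ne'
  have hS' := isSymmetric_symmetricStrategy (fun _ : Fin N => 1 / (N : ℝ))
    (fun _ => by positivity) (sum_one_div_card hN) χ h.norm_χ V
    (fun a => cyclicAverage p (S.povm a)) (fun a => posSemidef_cyclicAverage p
      (S.povm_posSemidef a))
    (by rw [cyclicAverage_add, S.povm_sum, cyclicAverage_one h.p_nonneg h.p_sum])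
  refine ⟨_, hS', ?_⟩
  have hb : ∀ a x, (symmetricStrategy (fun _ : Fin N => 1 / (N : ℝ)) hS'.p_nonneg hS'.p_sum χ
      h.norm_χ V (fun a => cyclicAverage p (S.povm a)) (fun a => posSemidef_cyclicAverage p
      (S.povm_posSemidef a)) (by rw [cyclicAverage_add, S.povm_sum,
        cyclicAverage_one h.p_nonneg h.p_sum])).behavior a x =
      1 / N * ∑ g, S.behavior a (fun i => x (i - g)) := by
    intro a x
    rw [hS'.behavior_eq]
    simp only [h.behavior_eq]
    exact quadForm_cyclicAverage p χ V x (S.povm a)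
  have hsingle : ∀ k g : Fin N, (fun i => (Pi.single k 1 : Fin N → Fin 2) (i - g)) =
      Pi.single (k + g) 1 := by
    intro k g
    ext i
    simp [Pi.single_apply, sub_eq_iff_eq_add]
  rw [h.violation_eq, hS'.violation_eq, hb]
  simp only [hb, hsingle]
  rw [← Finset.mul_sum, Finset.sum_comm]
  have hsum : ∀ g : Fin N, ∑ k, S.behavior 0 (Pi.single (k + g) 1) =
      ∑ k, S.behavior 0 (Pi.single k 1) := fun g =>
    Equiv.sum_comp (Equiv.addRight g) fun k => S.behavior 0 (Pi.single k 1)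
  simp only [hsum, Finset.sum_const, Finset.card_univ, Fintype.card_fin, nsmul_eq_mul]
  field_simp

theorem theorem1 (N : ℕ) (hN : 3 < N) :
    -- the maximal violation, for every internal dimension `d ≥ 2`
    (∀ d : ℕ, 2 ≤ d → IsGreatest (symmetricViolations N d)
      (1 / (((N : ℝ) + 1) * ((N : ℝ) ^ 2 - 3 * (N : ℝ) + 1)))) ∧
    -- no internal dimension whatsoever allows more
    (∀ d : ℕ, 1 / (((N : ℝ) + 1) * ((N : ℝ) ^ 2 - 3 * (N : ℝ) + 1)) ∈
      upperBounds (symmetricViolations N d)) ∧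
    -- it is achieved for `d = 2` and the uniform input state
    (∃ (S : QStrategy N 2) (χ : EuclideanSpace ℂ (Fin 2)) (V : Matrix.unitaryGroup (Fin 2) ℂ),
      S.IsSymmetric (fun _ => 1 / (N : ℝ)) χ V ∧
      S.violation = 1 / (((N : ℝ) + 1) * ((N : ℝ) ^ 2 - 3 * (N : ℝ) + 1))) ∧
    -- a non-uniform input state cannot increase the violation, for any fixed `χ` and `V`
    (∀ (d : ℕ) (S : QStrategy N d) (p : Fin N → ℝ) (χ : EuclideanSpace ℂ (Fin d))
      (V : Matrix.unitaryGroup (Fin d) ℂ), S.IsSymmetric p χ V →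
      ∃ S' : QStrategy N d, S'.IsSymmetric (fun _ => 1 / (N : ℝ)) χ V ∧
        S.violation ≤ S'.violation) := by
  have hub : ∀ d : ℕ, 1 / (((N : ℝ) + 1) * ((N : ℝ) ^ 2 - 3 * (N : ℝ) + 1)) ∈
      upperBounds (symmetricViolations N d) := by
    rintro d _ ⟨S, p, χ, V, hS, rfl⟩
    exact hS.violation_le hN
  refine ⟨fun d hd => ⟨?_, hub d⟩, hub, exists_optimal_strategy hN le_rfl, ?_⟩
  · obtain ⟨S, χ, V, hS, hv⟩ := exists_optimal_strategy hN hd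
    exact ⟨S, _, χ, V, hS, hv⟩
  · intro d S p χ V hS
    obtain ⟨S', hS', hv⟩ := hS.exists_uniform (by lia)
    exact ⟨S', hS', hv.le⟩
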